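/- Let $i\ge 1$ and $k=2i-1$, and let $z_j=(\cos\frac{2\pi j}{2i+1},\sin\frac{2\pi j}{2i+1})$, $j\in\mathbb{Z}/(2i+1)$, be the vertices of a regular $(2i+1)$-gon inscribed in the unit circle. For a finite family of points $\mathbf p_1,\dots,\mathbf p_n\in\mathbb{R}^d$ of affine dimension $d$, a Gale transform is the family of rows $\tilde{\mathbf p}_1,\dots,\tilde{\mathbf p}_n\in\mathbb{R}^{n-d-1}$ of a matrix whose columns form a basis of the space of affine dependences $\{a\in\mathbb{R}^n:\sum_j a_j\mathbf p_j=\mathbf 0,\ \sum_j a_j=0\}$; the corresponding Gale diagram is $\hat{\mathbf p}_1,\dots,\hat{\mathbf p}_n$, where $\hat{\mathbf p}_j=\tilde{\mathbf p}_j/\|\tilde{\mathbf p}_j\|$ if $\tilde{\mathbf p}_j\ne\mathbf 0$ and $\hat{\mathbf p}_j=\mathbf 0$ otherwise. There exist points $\mathbf x_j,\mathbf y_j\in\mathbb{R}^{2k+1}$ $(j\in\mathbb{Z}/(2i+1))$ having a Gale diagram with $\hat{\mathbf x}_j=\hat{\mathbf y}_j=z_j$ for all $j$. Moreover, for every such family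 of points, let $Q_k$ be its convex hull. Then: (1) the points $\mathbf x_j,\mathbf y_j$ are pairwise distinct and are exactly the vertices of $Q_k$, and $Q_k$ is a simplicial $(2k+1)$-polytope (all its proper faces are simplices) with $2k+4$ vertices; (2) $Q_k$ is neighborly, that is, the number of its faces with exactly $k=\lfloor (2k+1)/2\rfloor$ vertices is $\binom{2k+4}{k}$; (3) call a set of vertices of $Q_k$ a missing face if it is not the vertex set of a proper face of $Q_k$ (the empty face counting as a proper face) but all its proper subsets are. The missing faces of $Q_k$ are exactly the sets $\{\mathbf x_j,\mathbf y_j,\mathbf x_{j+1},\mathbf y_{j+1},\dots,\mathbf x_{j+i-1},\mathbf y_{j+i-1}\}$, $j\in\mathbb{Z}/(2i+1)$ (indices modulo $2i+1$). In particular, every missing face has $2i=k+1$ elements, i.e. has dimension $k$. -/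

import Mathlib

/-! ### Polytopes and their boundary complexes -/

namespace GalePolytope

/-- `F` is a proper face of the polytope `P`: the set of maximizers over `P` of a linear functional,
or the empty face, and different from `P`. -/
def IsProperFace {E : Type*} [NormedAddCommGroup E] [NormedSpace ℝ E] (P F : Set E) : Prop :=
  IsExposed ℝ P F ∧ F ≠ P

/-- A simplex (possibly empty): the convex hull of a finite affinely independent set. -/
def IsSimplex {E : Type*} [NormedAddCommGroup E] [NormedSpace ℝ E] (F : Set E) : Prop :=
  ∃ s : Finset E, AffineIndependent ℝ (fun x : s => (x : E)) ∧ F = convexHull ℝ (s : Set E)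

/-- A polytope is simplicial if all its proper faces are simplices. -/
def IsSimplicial {E : Type*} [NormedAddCommGroup E] [NormedSpace ℝ E] (P : Set E) : Prop :=
  ∀ F : Set E, IsProperFace P F → IsSimplex F

/-- The dimension of the affine span of `P`. -/
noncomputable def polytopeDim {E : Type*} [NormedAddCommGroup E] [NormedSpace ℝ E]
    (P : Set E) : ℕ :=
  Module.finrank ℝ (affineSpan ℝ P).direction

/-- The boundary complex: the collection of the vertex sets of the proper faces of `P`
(the empty face included). -/
def boundaryComplex {E : Type*} [NormedAddCommGroup E] [NormedSpace ℝ E]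
    (P : Set E) : Set (Finset E) :=
  {S | ∃ F : Set E, IsProperFace P F ∧ (S : Set E) = F.extremePoints ℝ}

/-- The number of faces with exactly `m` vertices, that is, `f_{m-1}`. -/
noncomputable def faceCount {α : Type*} (Δ : Set (Finset α)) (m : ℕ) : ℕ :=
  {S : Finset α | S ∈ Δ ∧ S.card = m}.ncard

/-- `Δ` is `m`-neighborly: `f_{m-1} = (f_0 choose m)`. -/
def IsMNeighborly {α : Type*} (Δ : Set (Finset α)) (m : ℕ) : Prop :=
  faceCount Δ m = (faceCount Δ 1).choose m

/-- A `d`-polytope is neighborly if its boundary complex is `⌊d/2⌋`-neighborly. -/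
def IsNeighborly {E : Type*} [NormedAddCommGroup E] [NormedSpace ℝ E] (P : Set E) : Prop :=
  IsMNeighborly (boundaryComplex P) (polytopeDim P / 2)

/-- A missing face of `Δ`: a set of vertices of `Δ` that is not a face, although all its proper
subsets are faces. -/
def IsMissingFace {α : Type*} (Δ : Set (Finset α)) (S : Finset α) : Prop :=
  (∀ v ∈ S, ({v} : Finset α) ∈ Δ) ∧ S ∉ Δ ∧ ∀ T : Finset α, T ⊂ S → T ∈ Δ

/-! ### Gale diagrams -/

/-- The space of affine dependences of a finite family of points. -/
def affineDependences {ι : Type*} [Fintype ι] {d : ℕ} (p : ι → EuclideanSpace ℝ (Fin d)) :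
    Submodule ℝ (ι → ℝ) where
  carrier := {a | ∑ j, a j • p j = 0 ∧ ∑ j, a j = 0}
  add_mem' := by
    rintro a b ⟨ha, ha'⟩ ⟨hb, hb'⟩
    simp [add_smul, Finset.sum_add_distrib, ha, ha', hb, hb']
  zero_mem' := by simp
  smul_mem' := by
    rintro c a ⟨ha, ha'⟩
    simp [mul_smul, ← Finset.smul_sum, ← Finset.mul_sum, ha, ha']

/-- `g` is a Gale transform of the family `p`: the points `g j` are the rows of a matrix whose
columns form a basis of the space of affine dependences of `p`. (Such a `g` with values in `ℝ^m`
exists only when `p` has affine dimension `|ι| - m - 1`; in particular `p` affinely spans `ℝ^d`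
when `m = |ι| - d - 1`.) -/
def IsGaleTransform {ι : Type*} [Fintype ι] {d m : ℕ} (p : ι → EuclideanSpace ℝ (Fin d))
    (g : ι → EuclideanSpace ℝ (Fin m)) : Prop :=
  ∃ b : Module.Basis (Fin m) ℝ (affineDependences p),
    ∀ (j : ι) (l : Fin m), g j l = (b l : ι → ℝ) j

/-- `h` is a Gale diagram of the family `p`: the nonzero points of a Gale transform are scaled to
unit length, the zero points stay zero. -/
def IsGaleDiagram {ι : Type*} [Fintype ι] {d m : ℕ} (p : ι → EuclideanSpace ℝ (Fin d))
    (h : ι → EuclideanSpace ℝ (Fin m)) : Prop :=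
  ∃ g : ι → EuclideanSpace ℝ (Fin m), IsGaleTransform p g ∧ ∀ j, h j = ‖g j‖⁻¹ • g j

/-- The vertex `z_j` of the regular `(2i+1)`-gon, at angle `2πj/(2i+1)`. -/
noncomputable def polygonVertex (i : ℕ) (j : ZMod (2 * i + 1)) : EuclideanSpace ℝ (Fin 2) :=
  !₂[Real.cos (2 * Real.pi * (j.val : ℝ) / (2 * (i : ℝ) + 1)),
    Real.sin (2 * Real.pi * (j.val : ℝ) / (2 * (i : ℝ) + 1))]

/-- The configuration with a double point at each vertex of the regular `(2i+1)`-gon: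
`(j, false)` is the point `x̂_j` and `(j, true)` is the point `ŷ_j`. -/
noncomputable def doublePolygon (i : ℕ) (v : ZMod (2 * i + 1) × Bool) :
    EuclideanSpace ℝ (Fin 2) :=
  polygonVertex i v.1

/-- The labels of the `i` consecutive double points at `z_j, z_{j+1}, …, z_{j+i-1}`. -/
def block (i : ℕ) (j : ZMod (2 * i + 1)) : Set (ZMod (2 * i + 1) × Bool) :=
  {v | ∃ t : ℕ, t < i ∧ v.1 = j + (t : ZMod (2 * i + 1))}

end GalePolytope

namespace GalePolytope

/-! ### Trigonometry of the regular polygon -/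

/-! Gale duality translates faces into linear relations between the `z_j`. The affine dependences of
the points are the vectors `c v * ⟨u, z_v⟩`, with `u` in the plane and fixed weights `c v > 0`
(`HasPolygonDependences`). The vectors orthogonal to them are exactly the value vectors of affine
functionals (`sum_affine_values`, `exists_affine_values`). So a proper label set `T` is cut out by a
supporting hyperplane iff some linear relation between the polygon points vanishes on `T` and is
positive off `T`.

If `T` contains a block of `i` consecutive double points, the other vertices lie in an open
half-plane and no such relation exists (`exists_halfPlane`). If `T` contains no block, each point
off `T` belongs to a triangle of points off `T` around the origin, and the relations of these
triangles add up to the required one (`exists_pos_relation`). Hence the faces are the sets without a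
full block (`mem_boundaryComplex_iff`). Blocks all have `2i = k + 1` elements, so every `k`-set is a
face and the minimal nonfaces are the blocks. Simpliciality holds because the vertices off such a
`T` span the plane, so no nonzero dependence is supported on `T`.

For existence the duality is run backwards: positive weights with `∑ c v • z_v = 0` give a
two-dimensional space of vectors with zero sum, which is realized as a space of affine dependences.
-/

/-- The angle of the vertex `z_j` of the regular `(2i+1)`-gon. -/
noncomputable def polygonAngle (i : ℕ) (j : ZMod (2 * i + 1)) : ℝ :=
  2 * Real.pi * (j.val : ℝ) / (2 * (i : ℝ) + 1)

theorem exists_polygonAngle_add (i : ℕ) (a : ZMod (2 * i + 1)) (m : ℕ) :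
    ∃ q : ℕ, polygonAngle i (a + m) =
      polygonAngle i a + 2 * Real.pi * m / (2 * i + 1) - q * (2 * Real.pi) := by
  -- The number of full turns made when `m` steps are taken from `a`.
  refine ⟨(a.val + m) / (2 * i + 1), ?_⟩
  have h1 : (a + m).val = (a.val + m) % (2 * i + 1) := by
    rw [ZMod.val_add, ZMod.val_natCast, Nat.add_mod_mod]
  have h2 : (((a.val + m) % (2 * i + 1) : ℕ) : ℝ) =
      a.val + m - (2 * i + 1) * ((a.val + m) / (2 * i + 1) : ℕ) := by
    have := Nat.mod_add_div (a.val + m) (2 * i + 1)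
    rw [eq_sub_iff_add_eq]
    exact_mod_cast this
  have h3 : (2 * (i : ℝ) + 1) ≠ 0 := by positivity
  rw [polygonAngle, polygonAngle, h1, h2]
  field_simp

/-- Since `2m < 2i + 1`, at most `i` steps make less than a half turn; oddness of the polygon rules
out antipodal vertices. -/
theorem sin_polygonAngle_sub_pos {i : ℕ} (a : ZMod (2 * i + 1)) {m : ℕ} (hm : 1 ≤ m)
    (hmi : m ≤ i) : 0 < Real.sin (polygonAngle i (a + m) - polygonAngle i a) := by
  obtain ⟨q, hq⟩ := exists_polygonAngle_add i a m
  rw [hq, show polygonAngle i a + 2 * Real.pi * m / (2 * i + 1) - q * (2 * Real.pi) -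
    polygonAngle i a = 2 * Real.pi * m / (2 * i + 1) - q * (2 * Real.pi) by ring,
    Real.sin_sub_nat_mul_two_pi]
  have h1 : (1 : ℝ) ≤ m := by exact_mod_cast hm
  have h2 : (m : ℝ) ≤ i := by exact_mod_cast hmi
  apply Real.sin_pos_of_pos_of_lt_pi
  · have := Real.pi_pos
    positivity
  · rw [div_lt_iff₀ (by positivity)]
    nlinarith [Real.pi_pos]

/-- A set of vertices meeting every `i` consecutive vertices surrounds the origin: each of its
points lies in a triangle of points of the set with the origin in its interior. -/
theorem exists_triangle {i : ℕ} {A : Set (ZMod (2 * i + 1))}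
    (hA : ∀ j : ZMod (2 * i + 1), ∃ t < i, j + (t : ZMod (2 * i + 1)) ∈ A)
    (a : ZMod (2 * i + 1)) :
    ∃ b ∈ A, ∃ c ∈ A, 0 < Real.sin (polygonAngle i c - polygonAngle i b) ∧
      0 < Real.sin (polygonAngle i a - polygonAngle i c) ∧
      0 < Real.sin (polygonAngle i b - polygonAngle i a) := by
  classical
  have h1 : ∃ m ≤ i, 1 ≤ m ∧ a + (m : ZMod (2 * i + 1)) ∈ A := by
    obtain ⟨t, ht, h⟩ := hA (a + 1)
    exact ⟨t + 1, by omega, by omega, by convert h using 1; push_cast; ring⟩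
  -- `b` is the last point of `A` within `i` steps after `a`, and `c` is a point of `A` within `i`
  -- steps after `b`.
  obtain ⟨m₀, hm₀i, hm₀⟩ := h1
  set P : ℕ → Prop := fun m => 1 ≤ m ∧ a + (m : ZMod (2 * i + 1)) ∈ A
  obtain ⟨hb1, hbA⟩ : P (Nat.findGreatest P i) := Nat.findGreatest_spec hm₀i hm₀
  have hbi : Nat.findGreatest P i ≤ i := Nat.findGreatest_le i
  have hmax : ∀ n, Nat.findGreatest P i < n → n ≤ i → ¬ P n :=
    fun n => Nat.findGreatest_is_greatest
  generalize Nat.findGreatest P i = m at *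
  obtain ⟨t, ht, hc⟩ := hA (a + m + 1)
  have hcA : a + ((m + (t + 1) : ℕ) : ZMod (2 * i + 1)) ∈ A := by
    convert hc using 1; push_cast; ring
  -- By maximality `c` is more than `i` steps from `a`, so at most `i` steps lead from `c` on to
  -- `a`: all three arcs are shorter than a half turn.
  have hlt : i < m + (t + 1) := by
    by_contra h
    exact hmax _ (by omega) (by omega) ⟨by omega, hcA⟩
  refine ⟨_, hbA, _, hcA, ?_, ?_, sin_polygonAngle_sub_pos a hb1 hbi⟩
  · have := sin_polygonAngle_sub_pos (a + (m : ZMod (2 * i + 1))) (m := t + 1)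
      (by omega) (by omega)
    convert this using 4
    push_cast; ring
  · have := sin_polygonAngle_sub_pos (a + ((m + (t + 1) : ℕ) : ZMod (2 * i + 1)))
      (m := 2 * i + 1 - (m + (t + 1))) (by omega) (by omega)
    convert this using 4
    rw [add_assoc, ← Nat.cast_add, Nat.add_sub_cancel' (by omega), ZMod.natCast_self, add_zero]

theorem mem_block_or {i : ℕ} (j : ZMod (2 * i + 1)) (v : ZMod (2 * i + 1) × Bool) :
    v ∈ block i j ∨ ∃ t ≤ i, v.1 = j + (i : ZMod (2 * i + 1)) + (t : ℕ) := by
  have h1 : v.1 = j + ((v.1 - j).val : ZMod (2 * i + 1)) := by simp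
  have h2 := ZMod.val_lt (v.1 - j)
  by_cases h : (v.1 - j).val < i
  · exact .inl ⟨_, h, h1⟩
  · refine .inr ⟨(v.1 - j).val - i, by omega, ?_⟩
    rw [add_assoc, ← Nat.cast_add, Nat.add_sub_cancel' (by omega)]
    exact h1

/-- The vertices outside a block lie in an open half-plane. -/
theorem exists_halfPlane (i : ℕ) (j : ZMod (2 * i + 1)) :
    ∃ x y : ℝ, ∀ v ∉ block i j,
      0 < x * Real.cos (polygonAngle i v.1) + y * Real.sin (polygonAngle i v.1) := by
  -- The direction of the midpoint of the arc from `z_{j+i}` to `z_{j+2i}`; the vertices outside the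
  -- block deviate from it by at most `iπ/(2i+1) < π/2`.
  set φ := polygonAngle i (j + (i : ZMod (2 * i + 1))) + i * Real.pi / (2 * i + 1)
  refine ⟨Real.cos φ, Real.sin φ, fun v hv => ?_⟩
  obtain ⟨t, ht, hvt⟩ := (mem_block_or j v).resolve_left hv
  obtain ⟨q, hq⟩ := exists_polygonAngle_add i (j + (i : ZMod (2 * i + 1))) t
  have h1 : Real.cos φ * Real.cos (polygonAngle i v.1) +
      Real.sin φ * Real.sin (polygonAngle i v.1) = Real.cos (polygonAngle i v.1 - φ) := by
    rw [Real.cos_sub]; ring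
  have h2 : polygonAngle i v.1 - φ = (2 * t - i) * Real.pi / (2 * i + 1) - q * (2 * Real.pi) := by
    rw [hvt, hq]; simp only [φ]; ring
  rw [h1, h2, Real.cos_sub_nat_mul_two_pi]
  have h3 : (t : ℝ) ≤ i := by exact_mod_cast ht
  have h4 : (0 : ℝ) ≤ t := by positivity
  have := Real.pi_pos
  apply Real.cos_pos_of_mem_Ioo
  constructor
  · rw [lt_div_iff₀ (by positivity)]; nlinarith
  · rw [div_lt_iff₀ (by positivity)]; nlinarith

/-- A set of labels without a full block has a complement carrying a strictly positive linear
relation between the vertices. -/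
theorem exists_pos_relation {i : ℕ} {T : Set (ZMod (2 * i + 1) × Bool)}
    (hT : ∀ j, ¬ block i j ⊆ T) :
    ∃ w : ZMod (2 * i + 1) × Bool → ℝ, (∀ v ∈ T, w v = 0) ∧ (∀ v ∉ T, 0 < w v) ∧
      ∑ v, w v * Real.cos (polygonAngle i v.1) = 0 ∧
      ∑ v, w v * Real.sin (polygonAngle i v.1) = 0 := by
  classical
  have hA : ∀ j : ZMod (2 * i + 1), ∃ t < i, j + (t : ZMod (2 * i + 1)) ∈ Prod.fst '' Tᶜ := by
    intro j
    obtain ⟨v, ⟨t, ht, hv⟩, hvT⟩ := Set.not_subset.1 (hT j)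
    exact ⟨t, ht, v, hvT, hv⟩
  have key : ∀ v : ZMod (2 * i + 1) × Bool, ∃ w : ZMod (2 * i + 1) × Bool → ℝ,
      (∀ u, 0 ≤ w u) ∧ (∀ u ∈ T, w u = 0) ∧ (v ∉ T → 0 < w v) ∧
      ∑ v, w v * Real.cos (polygonAngle i v.1) = 0 ∧
      ∑ v, w v * Real.sin (polygonAngle i v.1) = 0 := by
    intro v
    by_cases hv : v ∈ T
    · exact ⟨0, by simp, by simp, by simp [hv], by simp, by simp⟩
    obtain ⟨_, ⟨b, hb, rfl⟩, _, ⟨c, hc, rfl⟩, h1, h2, h3⟩ := exists_triangle hA v.1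
    -- Cramer's rule: each vertex of the triangle is weighted by the determinant of the other two.
    refine ⟨Pi.single v (Real.sin (polygonAngle i c.1 - polygonAngle i b.1)) +
      Pi.single b (Real.sin (polygonAngle i v.1 - polygonAngle i c.1)) +
      Pi.single c (Real.sin (polygonAngle i b.1 - polygonAngle i v.1)), ?_, ?_, ?_, ?_, ?_⟩
    · have (x : ZMod (2 * i + 1) × Bool) {r : ℝ} (hr : 0 < r) (u) :
          0 ≤ (Pi.single x r : ZMod (2 * i + 1) × Bool → ℝ) u :=
        (Pi.single_nonneg.2 hr.le : (0 : ZMod (2 * i + 1) × Bool → ℝ) ≤ _) u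
      exact fun u => add_nonneg (add_nonneg (this _ h1 u) (this _ h2 u)) (this _ h3 u)
    · intro u hu
      have hne : ∀ x ∉ T, u ≠ x := fun x hx h => hx (h ▸ hu)
      simp [hne v hv, hne b hb, hne c hc]
    · intro _
      simp only [Pi.add_apply, Pi.single_apply, if_true]
      split_ifs <;> linarith
    · simp only [Pi.add_apply, add_mul, Finset.sum_add_distrib, Pi.single_apply, ite_mul, zero_mul,
        Finset.sum_ite_eq', Finset.mem_univ, if_true, Real.sin_sub]
      ring
    · simp only [Pi.add_apply, add_mul, Finset.sum_add_distrib, Pi.single_apply, ite_mul, zero_mul,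
        Finset.sum_ite_eq', Finset.mem_univ, if_true, Real.sin_sub]
      ring
  choose w hw0 hwT hwpos hwc hws using key
  refine ⟨fun u => ∑ v, w v u, fun u hu => Finset.sum_eq_zero fun v _ => hwT v u hu,
    fun u hu => Finset.sum_pos' (fun v _ => hw0 v u) ⟨u, Finset.mem_univ _, hwpos u hu⟩, ?_, ?_⟩
  · simp_rw [Finset.sum_mul]
    rw [Finset.sum_comm]
    exact Finset.sum_eq_zero fun v _ => hwc v
  · simp_rw [Finset.sum_mul]
    rw [Finset.sum_comm]
    exact Finset.sum_eq_zero fun v _ => hws v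

/-- The vertices outside a set of labels without a full block span the plane. -/
theorem eq_zero_of_forall_notMem {i : ℕ} {T : Set (ZMod (2 * i + 1) × Bool)}
    (hT : ∀ j, ¬ block i j ⊆ T) {x y : ℝ}
    (h : ∀ v ∉ T, x * Real.cos (polygonAngle i v.1) + y * Real.sin (polygonAngle i v.1) = 0) :
    x = 0 ∧ y = 0 := by
  have hA : ∀ j : ZMod (2 * i + 1), ∃ t < i, j + (t : ZMod (2 * i + 1)) ∈ Prod.fst '' Tᶜ := by
    intro j
    obtain ⟨v, ⟨t, ht, hv⟩, hvT⟩ := Set.not_subset.1 (hT j)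
    exact ⟨t, ht, v, hvT, hv⟩
  -- `h1` says that the vertices at `b` and `c` have nonzero determinant; the starting vertex `0` is
  -- arbitrary.
  obtain ⟨_, ⟨b, hb, rfl⟩, _, ⟨c, hc, rfl⟩, h1, -, -⟩ := exists_triangle hA 0
  have hb' := h b hb
  have hc' := h c hc
  rw [Real.sin_sub] at h1
  constructor
  · refine (mul_eq_zero.1 ?_).resolve_right h1.ne'
    linear_combination Real.sin (polygonAngle i c.1) * hb' - Real.sin (polygonAngle i b.1) * hc'
  · refine (mul_eq_zero.1 ?_).resolve_right h1.ne'
    linear_combination Real.cos (polygonAngle i b.1) * hc' - Real.cos (polygonAngle i c.1) * hb'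

/-! ### Combinatorics of blocks -/

theorem ncard_block (i : ℕ) (j : ZMod (2 * i + 1)) : (block i j).ncard = 2 * i := by
  classical
  have h : block i j = (((Finset.range i).image fun t : ℕ => j + (t : ZMod (2 * i + 1))) ×ˢ
      (Finset.univ : Finset Bool) : Finset _) := by
    ext v
    rw [Finset.mem_coe, Finset.mem_product, Finset.mem_image]
    constructor
    · rintro ⟨t, ht, hv⟩
      exact ⟨⟨t, Finset.mem_range.2 ht, hv.symm⟩, Finset.mem_univ _⟩
    · rintro ⟨⟨t, ht, hv⟩, -⟩
      exact ⟨t, Finset.mem_range.1 ht, hv.symm⟩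
  rw [h, Set.ncard_coe_finset, Finset.card_product, Finset.card_image_of_injOn, Finset.card_range,
    Finset.card_univ, Fintype.card_bool, mul_comm]
  intro s hs t ht hst
  simp only [Finset.coe_range, Set.mem_Iio] at hs ht
  have := congrArg ZMod.val (add_left_cancel hst)
  rwa [ZMod.val_natCast_of_lt (by omega), ZMod.val_natCast_of_lt (by omega)] at this

theorem not_block_subset {i : ℕ} {T : Finset (ZMod (2 * i + 1) × Bool)} (hT : T.card < 2 * i)
    (j : ZMod (2 * i + 1)) : ¬ block i j ⊆ T := fun h => by
  have := Set.ncard_le_ncard h T.finite_toSet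
  rw [ncard_block, Set.ncard_coe_finset] at this
  omega

/-! ### Affine functionals and affine dependences -/

section Duality

variable {ι : Type*} [Fintype ι] {d m : ℕ}

/-- The homogenization of a point family: `a ↦ (∑ a_j p_j, ∑ a_j)`. -/
noncomputable def homogenization (p : ι → EuclideanSpace ℝ (Fin d)) :
    (ι → ℝ) →ₗ[ℝ] EuclideanSpace ℝ (Fin d) × ℝ :=
  (Fintype.linearCombination ℝ p).prod (Fintype.linearCombination ℝ fun _ => (1 : ℝ))

theorem homogenization_apply (p : ι → EuclideanSpace ℝ (Fin d)) (a : ι → ℝ) :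
    homogenization p a = (∑ j, a j • p j, ∑ j, a j) := by
  simp [homogenization, Fintype.linearCombination_apply]

theorem mem_affineDependences {p : ι → EuclideanSpace ℝ (Fin d)} {a : ι → ℝ} :
    a ∈ affineDependences p ↔ ∑ j, a j • p j = 0 ∧ ∑ j, a j = 0 := Iff.rfl

theorem ker_homogenization (p : ι → EuclideanSpace ℝ (Fin d)) :
    LinearMap.ker (homogenization p) = affineDependences p := by
  ext a
  rw [LinearMap.mem_ker, homogenization_apply, Prod.mk_eq_zero, mem_affineDependences]

/-- The values of an affine functional on a point family are orthogonal to the affine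
dependences. -/
theorem sum_affine_values {p : ι → EuclideanSpace ℝ (Fin d)} {a : ι → ℝ}
    (ha : a ∈ affineDependences p) (l : StrongDual ℝ (EuclideanSpace ℝ (Fin d))) (β : ℝ) :
    ∑ j, a j * (β - l (p j)) = 0 := by
  have h := congrArg l ha.1
  simp only [map_sum, map_smul, smul_eq_mul, map_zero] at h
  simp_rw [mul_sub, Finset.sum_sub_distrib, ← Finset.sum_mul]
  rw [h, ha.2]
  simp

/-- Every vector orthogonal to the affine dependences is the vector of values of an affine
functional. -/
theorem exists_affine_values {p : ι → EuclideanSpace ℝ (Fin d)} {t : ι → ℝ}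
    (ht : ∀ a ∈ affineDependences p, ∑ j, a j * t j = 0) :
    ∃ (l : StrongDual ℝ (EuclideanSpace ℝ (Fin d))) (β : ℝ), ∀ j, β - l (p j) = t j := by
  classical
  -- The range of a dual map is the annihilator of the kernel, here of the affine dependences.
  have h : Fintype.linearCombination ℝ t ∈ LinearMap.range (homogenization p).dualMap := by
    rw [LinearMap.range_dualMap_eq_dualAnnihilator_ker, Submodule.mem_dualAnnihilator,
      ker_homogenization]
    intro a ha
    simpa [Fintype.linearCombination_apply] using ht a ha
  obtain ⟨φ, hφ⟩ := h
  refine ⟨-LinearMap.toContinuousLinearMap (φ ∘ₗ LinearMap.inl ℝ _ ℝ), φ (0, 1), fun j => ?_⟩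
  have hj := LinearMap.congr_fun hφ (Pi.single j 1)
  rw [Fintype.linearCombination_apply_single, one_smul, LinearMap.dualMap_apply,
    homogenization_apply] at hj
  rw [← hj]
  have h1 : ∑ k, (Pi.single j 1 : ι → ℝ) k • p k = p j := by
    simp [Pi.single_apply]
  have h2 : ∑ k, (Pi.single j 1 : ι → ℝ) k = 1 := by simp
  rw [h1, h2]
  have h3 : (p j, (1 : ℝ)) = (0, 1) + (p j, 0) := by simp
  rw [h3, map_add]
  simp

/-- A point family with a space of affine dependences of the expected dimension is affinely
spanning. -/
theorem polytopeDim_convexHull_range {p : ι → EuclideanSpace ℝ (Fin d)}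
    (h : Module.finrank ℝ (affineDependences p) + (d + 1) = Fintype.card ι) :
    polytopeDim (convexHull ℝ (Set.range p)) = d := by
  have h1 := (homogenization p).finrank_range_add_finrank_ker
  rw [ker_homogenization, Module.finrank_fintype_fun_eq_card] at h1
  have h2 : LinearMap.range (homogenization p) = ⊤ := by
    apply Submodule.eq_top_of_finrank_eq
    rw [Module.finrank_prod, finrank_euclideanSpace_fin, Module.finrank_self]
    omega
  have h3 : vectorSpan ℝ (Set.range p) = ⊤ := by
    rw [eq_top_iff]
    intro x _
    obtain ⟨a, ha⟩ : (x, (0 : ℝ)) ∈ LinearMap.range (homogenization p) := h2 ▸ trivial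
    rw [homogenization_apply, Prod.mk.injEq] at ha
    have := weightedVSub_mem_vectorSpan ha.2 p
    rwa [Finset.univ.weightedVSub_eq_linear_combination ha.2, ha.1] at this
  rw [polytopeDim, affineSpan_convexHull, direction_affineSpan, h3, finrank_top,
    finrank_euclideanSpace_fin]

/-- The affine dependences are the vectors of values of linear functionals on a Gale transform. -/
theorem IsGaleTransform.mem_affineDependences_iff {p : ι → EuclideanSpace ℝ (Fin d)}
    {g : ι → EuclideanSpace ℝ (Fin m)} (h : IsGaleTransform p g) (a : ι → ℝ) :
    a ∈ affineDependences p ↔ ∃ u : Fin m → ℝ, ∀ j, a j = ∑ l, u l * g j l := by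
  obtain ⟨b, hb⟩ := h
  have hsum : ∀ (u : Fin m → ℝ) (j : ι),
      ((∑ l, u l • b l : affineDependences p) : ι → ℝ) j = ∑ l, u l * g j l := by
    intro u j
    simp [hb, Finset.sum_apply]
  constructor
  · intro ha
    refine ⟨b.repr ⟨a, ha⟩, fun j => ?_⟩
    rw [← hsum, b.sum_repr]
  · rintro ⟨u, hu⟩
    have : a = ((∑ l, u l • b l : affineDependences p) : ι → ℝ) := by
      ext j
      rw [hu, hsum]
    rw [this]
    exact Subtype.property _

end Duality

/-! ### Faces of the convex hull of a point family -/

section Faces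

variable {ι : Type*} {E : Type*} [NormedAddCommGroup E] [NormedSpace ℝ E]
  {p : ι → E}

theorem le_of_mem_convexHull_range {l : StrongDual ℝ E} {β : ℝ} (h : ∀ j, l (p j) ≤ β)
    {x : E} (hx : x ∈ convexHull ℝ (Set.range p)) : l x ≤ β := by
  have hc : Convex ℝ {y | l y ≤ β} := convex_halfSpace_le l.toLinearMap.isLinear β
  have hs : Set.range p ⊆ {y | l y ≤ β} := by
    rintro _ ⟨j, rfl⟩
    exact h j
  exact convexHull_min hs hc hx

theorem isExposed_of_values {l : StrongDual ℝ E} {β : ℝ} (h : ∀ j, l (p j) ≤ β)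
    {j₀ : ι} (hj₀ : l (p j₀) = β) :
    IsExposed ℝ (convexHull ℝ (Set.range p)) {x ∈ convexHull ℝ (Set.range p) | l x = β} := by
  intro _
  refine ⟨l, ?_⟩
  ext x
  constructor
  · rintro ⟨hx, hxl⟩
    exact ⟨hx, fun y hy => hxl ▸ le_of_mem_convexHull_range h hy⟩
  · rintro ⟨hx, hxl⟩
    refine ⟨hx, le_antisymm (le_of_mem_convexHull_range h hx) ?_⟩
    rw [← hj₀]
    exact hxl _ (subset_convexHull ℝ _ ⟨j₀, rfl⟩)

/-- A nonempty proper face is cut out by a linear functional that is bounded on the points and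
not constant on them. -/
theorem IsProperFace.exists_values {F : Set E}
    (hF : IsProperFace (convexHull ℝ (Set.range p)) F) (hne : F.Nonempty) :
    ∃ (l : StrongDual ℝ E) (β : ℝ), (∀ j, l (p j) ≤ β) ∧ (∃ j, l (p j) ≠ β) ∧
      ∀ j, p j ∈ F ↔ l (p j) = β := by
  obtain ⟨l, hl⟩ := hF.1 hne
  obtain ⟨x₀, hx₀⟩ := hne
  have hx₀' := hl ▸ hx₀
  have hmem : ∀ j, p j ∈ convexHull ℝ (Set.range p) := fun j => subset_convexHull ℝ _ ⟨j, rfl⟩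
  have hle : ∀ j, l (p j) ≤ l x₀ := fun j => hx₀'.2 _ (hmem j)
  refine ⟨l, l x₀, hle, ?_, fun j => ?_⟩
  -- If `l` is constant on the points, it is constant on their hull, and the face is the whole
  -- polytope.
  · by_contra! hall
    apply hF.2
    refine hF.1.subset.antisymm fun x hx => ?_
    rw [hl]
    refine ⟨hx, fun y hy => (le_of_mem_convexHull_range hle hy).trans ?_⟩
    have := le_of_mem_convexHull_range (l := -l) (β := -l x₀) (fun j => by simp [hall j]) hx
    simpa using this
  · rw [hl]
    refine ⟨fun h => le_antisymm (hle j) (h.2 _ hx₀'.1), fun h => ⟨hmem j, fun y hy => ?_⟩⟩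
    rw [h]
    exact hx₀'.2 y hy

theorem IsExposed.extremePoints_eq_inter {P F : Set E} (h : IsExposed ℝ P F) :
    F.extremePoints ℝ = F ∩ P.extremePoints ℝ :=
  h.isExtreme.extremePoints_eq

/-- Krein–Milman for the compact face, whose extreme points are the extreme points of the polytope
lying in it; hulls of finite sets are already closed. -/
theorem IsExposed.eq_convexHull [Finite ι] {F : Set E}
    (h : IsExposed ℝ (convexHull ℝ (Set.range p)) F)
    (hP : (convexHull ℝ (Set.range p)).extremePoints ℝ = Set.range p) :
    F = convexHull ℝ (p '' {j | p j ∈ F}) := by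
  have hfin := Set.finite_range p
  have h1 := closure_convexHull_extremePoints (h.isCompact (hfin.isCompact_convexHull ℝ))
    (h.convex (convex_convexHull ℝ _))
  have h2 : F ∩ Set.range p = p '' {j | p j ∈ F} := by
    ext x
    constructor
    · rintro ⟨hx, j, rfl⟩
      exact ⟨j, hx, rfl⟩
    · rintro ⟨j, hj, rfl⟩
      exact ⟨hj, j, rfl⟩
  rw [IsExposed.extremePoints_eq_inter h, hP, h2,
    ((Set.toFinite {j | p j ∈ F}).image p).isClosed_convexHull ℝ |>.closure_eq] at h1
  exact h1.symm

end Faces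

/-! ### Polytopes with a doubled odd polygon as Gale diagram -/

/-- The affine dependences of `p` are, up to the positive weights `c`, the values of the linear
functionals on the doubled polygon. -/
structure HasPolygonDependences {i d : ℕ} (p : ZMod (2 * i + 1) × Bool → EuclideanSpace ℝ (Fin d))
    (c : ZMod (2 * i + 1) × Bool → ℝ) : Prop where
  pos : ∀ v, 0 < c v
  mem_iff : ∀ a, a ∈ affineDependences p ↔ ∃ x y : ℝ, ∀ v,
    a v = c v * (x * Real.cos (polygonAngle i v.1) + y * Real.sin (polygonAngle i v.1))

theorem polygonVertex_zero (i : ℕ) (j : ZMod (2 * i + 1)) :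
    polygonVertex i j 0 = Real.cos (polygonAngle i j) := rfl

theorem polygonVertex_one (i : ℕ) (j : ZMod (2 * i + 1)) :
    polygonVertex i j 1 = Real.sin (polygonAngle i j) := rfl

theorem norm_polygonVertex (i : ℕ) (j : ZMod (2 * i + 1)) : ‖polygonVertex i j‖ = 1 := by
  rw [EuclideanSpace.norm_eq, Fin.sum_univ_two, polygonVertex_zero, polygonVertex_one]
  simp

section

variable {i d : ℕ} {p : ZMod (2 * i + 1) × Bool → EuclideanSpace ℝ (Fin d)}
  {c : ZMod (2 * i + 1) × Bool → ℝ}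

/-- The weights are the norms lost in passing from the Gale transform to the diagram; they are
positive because no `z_j` is zero. -/
theorem IsGaleDiagram.exists_hasPolygonDependences (h : IsGaleDiagram p (doublePolygon i)) :
    ∃ c, HasPolygonDependences p c := by
  obtain ⟨g, hg, hz⟩ := h
  have hpos : ∀ v, 0 < ‖g v‖ := by
    intro v
    rw [norm_pos_iff]
    intro h0
    have h1 := norm_polygonVertex i v.1
    rw [← doublePolygon, hz, h0] at h1
    simp at h1
  have hgv : ∀ v, g v = ‖g v‖ • polygonVertex i v.1 := by
    intro v
    rw [← doublePolygon, hz, smul_smul, mul_inv_cancel₀ (hpos v).ne', one_smul]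
  refine ⟨fun v => ‖g v‖, hpos, fun a => ?_⟩
  rw [hg.mem_affineDependences_iff]
  have key : ∀ v (x y : ℝ), x * g v 0 + y * g v 1 =
      ‖g v‖ * (x * Real.cos (polygonAngle i v.1) + y * Real.sin (polygonAngle i v.1)) := by
    intro v x y
    have h0 : g v 0 = ‖g v‖ * Real.cos (polygonAngle i v.1) := congrFun (congrArg _ (hgv v)) 0
    have h1 : g v 1 = ‖g v‖ * Real.sin (polygonAngle i v.1) := congrFun (congrArg _ (hgv v)) 1
    rw [h0, h1]
    ring
  constructor
  · rintro ⟨u, hu⟩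
    exact ⟨u 0, u 1, fun v => by rw [hu, Fin.sum_univ_two, key]⟩
  · rintro ⟨x, y, hxy⟩
    exact ⟨![x, y], fun v => by rw [hxy, Fin.sum_univ_two, ← key]; rfl⟩

theorem IsGaleDiagram.finrank_affineDependences {m : ℕ}
    {h : ZMod (2 * i + 1) × Bool → EuclideanSpace ℝ (Fin m)} (hg : IsGaleDiagram p h) :
    Module.finrank ℝ (affineDependences p) = m := by
  obtain ⟨g, ⟨b, -⟩, -⟩ := hg
  rw [Module.finrank_eq_card_basis b, Fintype.card_fin]

/-- The points of a set of labels without a full block are cut out by a supporting hyperplane. -/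
theorem HasPolygonDependences.exists_support (hp : HasPolygonDependences p c)
    {T : Set (ZMod (2 * i + 1) × Bool)} (hT : ∀ j, ¬ block i j ⊆ T) :
    ∃ (l : StrongDual ℝ (EuclideanSpace ℝ (Fin d))) (β : ℝ), (∀ v ∈ T, l (p v) = β) ∧
      ∀ v ∉ T, l (p v) < β := by
  obtain ⟨w, hw0, hwpos, hwc, hws⟩ := exists_pos_relation hT
  -- Dividing by `c` turns a relation between the polygon vertices into a vector orthogonal to the
  -- dependences.
  have key : ∀ a ∈ affineDependences p, ∑ v, a v * (w v / c v) = 0 := by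
    intro a ha
    obtain ⟨x, y, hxy⟩ := (hp.mem_iff a).1 ha
    have : ∀ v, a v * (w v / c v) = x * (w v * Real.cos (polygonAngle i v.1)) +
        y * (w v * Real.sin (polygonAngle i v.1)) := by
      intro v
      rw [hxy]
      have := (hp.pos v).ne'
      field_simp
    simp_rw [this, Finset.sum_add_distrib, ← Finset.mul_sum, hwc, hws]
    simp
  obtain ⟨l, β, hl⟩ := exists_affine_values key
  refine ⟨l, β, fun v hv => ?_, fun v hv => ?_⟩
  · have := hl v
    rw [hw0 v hv, zero_div] at this
    linarith
  · have := hl v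
    have := div_pos (hwpos v hv) (hp.pos v)
    linarith

/-- An affine functional that is nonnegative on the points and vanishes on a block vanishes on all
points. -/
theorem HasPolygonDependences.eq_of_block (hp : HasPolygonDependences p c)
    {l : StrongDual ℝ (EuclideanSpace ℝ (Fin d))} {β : ℝ} (hl : ∀ v, l (p v) ≤ β)
    {j : ZMod (2 * i + 1)} (hj : ∀ v ∈ block i j, l (p v) = β) (v) : l (p v) = β := by
  obtain ⟨x, y, hxy⟩ := exists_halfPlane i j
  -- This dependence is positive off the block; on the block its sign is irrelevant because `β - l`
  -- vanishes there. All terms of the zero sum are thus nonnegative.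
  have h0 := sum_affine_values ((hp.mem_iff _).2 ⟨x, y, fun v => rfl⟩) l β
  rw [Finset.sum_eq_zero_iff_of_nonneg] at h0
  · by_cases hv : v ∈ block i j
    · exact hj v hv
    · have h1 := h0 v (Finset.mem_univ v)
      have := (mul_eq_zero.1 h1).resolve_left (mul_pos (hp.pos v) (hxy v hv)).ne'
      linarith
  · intro u _
    by_cases hu : u ∈ block i j
    · rw [hj u hu, sub_self, mul_zero]
    · exact mul_nonneg (mul_pos (hp.pos u) (hxy u hu)).le (sub_nonneg.2 (hl u))

/-- A dependence supported on `T`, extended by zero, comes from a linear functional vanishing at all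
vertices off `T`. These span the plane, so the functional is zero. -/
theorem HasPolygonDependences.affineIndependent (hp : HasPolygonDependences p c)
    {T : Set (ZMod (2 * i + 1) × Bool)} (hT : ∀ j, ¬ block i j ⊆ T) :
    AffineIndependent ℝ fun v : T => p v := by
  classical
  rw [affineIndependent_iff]
  intro s w hw0 hwp
  set s' : Finset (ZMod (2 * i + 1) × Bool) := s.map (Function.Embedding.subtype _)
  set a : ZMod (2 * i + 1) × Bool → ℝ :=
    fun v => if h : v ∈ T then (if ⟨v, h⟩ ∈ s then w ⟨v, h⟩ else 0) else 0
  have haT : ∀ v : T, a v = if v ∈ s then w v else 0 := fun v => by simp [a]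
  have hsum : ∀ {M : Type} [AddCommMonoid M] (f : ZMod (2 * i + 1) × Bool → M),
      (∀ v ∉ s', f v = 0) → ∑ v, f v = ∑ v ∈ s, f v := by
    intro M _ f hf
    rw [← Finset.sum_subset (Finset.subset_univ s') fun v _ hv => hf v hv, Finset.sum_map]
    rfl
  have has : ∀ v ∉ s', a v = 0 := by
    intro v hv
    by_cases h : v ∈ T
    · have : (⟨v, h⟩ : T) ∉ s := fun hvs => hv (Finset.mem_map.2 ⟨_, hvs, rfl⟩)
      simp [a, this]
    · simp [a, h]
  have ha : a ∈ affineDependences p := by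
    refine mem_affineDependences.2 ⟨?_, ?_⟩
    · rw [hsum _ fun v hv => by rw [has v hv, zero_smul], ← hwp]
      exact Finset.sum_congr rfl fun v hv => by rw [haT, if_pos hv]
    · rw [hsum _ has, ← hw0]
      exact Finset.sum_congr rfl fun v hv => by rw [haT, if_pos hv]
  obtain ⟨x, y, hxy⟩ := (hp.mem_iff a).1 ha
  obtain ⟨rfl, rfl⟩ := eq_zero_of_forall_notMem hT (x := x) (y := y) fun v hv => by
    have h1 := hxy v
    rw [show a v = 0 by simp [a, hv]] at h1
    exact (mul_eq_zero.1 h1.symm).resolve_left (hp.pos v).ne'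
  intro v hv
  have h1 := hxy v
  rw [haT, if_pos hv] at h1
  simpa using h1

theorem HasPolygonDependences.injective (hp : HasPolygonDependences p c) (hi : 1 ≤ i) :
    Function.Injective p := by
  intro v w hvw
  by_contra hne
  have hT : ∀ j, ¬ block i j ⊆ (({v} : Finset (ZMod (2 * i + 1) × Bool)) : Set _) :=
    not_block_subset (by rw [Finset.card_singleton]; omega)
  obtain ⟨l, β, h1, h2⟩ := hp.exists_support hT
  have h3 := h1 v (by simp)
  have h4 := h2 w (by simpa using Ne.symm hne)
  rw [hvw] at h3
  exact h4.ne h3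

/-- The points of a set of labels without a full block are the extreme points of a proper face. -/
theorem HasPolygonDependences.exists_face (hp : HasPolygonDependences p c)
    {T : Set (ZMod (2 * i + 1) × Bool)} (hT : ∀ j, ¬ block i j ⊆ T) :
    ∃ F, IsProperFace (convexHull ℝ (Set.range p)) F ∧ ∀ v, p v ∈ F ↔ v ∈ T := by
  have hmem : ∀ v, p v ∈ convexHull ℝ (Set.range p) := fun v => subset_convexHull ℝ _ ⟨v, rfl⟩
  rcases T.eq_empty_or_nonempty with rfl | ⟨v₀, hv₀⟩
  · exact ⟨∅, ⟨isExposed_empty, fun h => by simpa [← h] using hmem 0⟩, by simp⟩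
  obtain ⟨l, β, h1, h2⟩ := hp.exists_support hT
  have hle : ∀ v, l (p v) ≤ β := fun v => by
    by_cases hv : v ∈ T
    · exact (h1 v hv).le
    · exact (h2 v hv).le
  have hiff : ∀ v, p v ∈ {x ∈ convexHull ℝ (Set.range p) | l x = β} ↔ v ∈ T := fun v =>
    ⟨fun h => by_contra fun hv => (h2 v hv).ne h.2, fun hv => ⟨hmem v, h1 v hv⟩⟩
  -- The face is proper: otherwise `T` would contain every label, in particular the block at `0`.
  refine ⟨_, ⟨isExposed_of_values hle (h1 v₀ hv₀), fun h => hT 0 fun v _ => ?_⟩, hiff⟩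
  rw [← hiff, h]
  exact hmem v

/-- A singleton contains no block, so some face contains `p v` and no other point of the family.
That face has an extreme point, which can only be `p v`. -/
theorem HasPolygonDependences.extremePoints_eq (hp : HasPolygonDependences p c) (hi : 1 ≤ i) :
    (convexHull ℝ (Set.range p)).extremePoints ℝ = Set.range p := by
  refine extremePoints_convexHull_subset.antisymm ?_
  rintro _ ⟨v, rfl⟩
  have hT : ∀ j, ¬ block i j ⊆ (({v} : Finset (ZMod (2 * i + 1) × Bool)) : Set _) :=
    not_block_subset (by rw [Finset.card_singleton]; omega)
  obtain ⟨F, hF, hFv⟩ := hp.exists_face hT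
  have hne : F.Nonempty := ⟨p v, (hFv v).2 (by simp)⟩
  obtain ⟨x, hx⟩ := (hF.1.isCompact
    ((Set.finite_range p).isCompact_convexHull ℝ)).extremePoints_nonempty hne
  rw [IsExposed.extremePoints_eq_inter hF.1] at hx
  obtain ⟨w, rfl⟩ := extremePoints_convexHull_subset hx.2
  have : w = v := by simpa using (hFv w).1 hx.1
  exact this ▸ hx.2

theorem HasPolygonDependences.not_block_subset_face (hp : HasPolygonDependences p c)
    (hi : 1 ≤ i) {F : Set (EuclideanSpace ℝ (Fin d))}
    (hF : IsProperFace (convexHull ℝ (Set.range p)) F) (j : ZMod (2 * i + 1)) :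
    ¬ block i j ⊆ {v | p v ∈ F} := by
  intro hj
  have hne : F.Nonempty := ⟨p (j, false), hj ⟨0, by omega, by simp⟩⟩
  obtain ⟨l, β, hle, ⟨v, hv⟩, hiff⟩ := hF.exists_values hne
  exact hv (hp.eq_of_block hle (fun u hu => (hiff u).1 (hj hu)) v)

theorem HasPolygonDependences.isSimplicial (hp : HasPolygonDependences p c) (hi : 1 ≤ i) :
    IsSimplicial (convexHull ℝ (Set.range p)) := by
  classical
  intro F hF
  have hfin : {v | p v ∈ F}.Finite := Set.toFinite _
  have hind := (hp.affineIndependent (hp.not_block_subset_face hi hF)).range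
  have hs : ((hfin.image p).toFinset : Set (EuclideanSpace ℝ (Fin d))) = p '' {v | p v ∈ F} :=
    Set.Finite.coe_toFinset _
  refine ⟨(hfin.image p).toFinset, ?_, ?_⟩
  · have h2 : Set.range (fun v : {v | p v ∈ F} => p v) = p '' {v | p v ∈ F} :=
      (Set.image_eq_range p _).symm
    rw [h2] at hind
    exact hind.mono (Set.Finite.coe_toFinset _).subset
  · rw [hs]
    exact IsExposed.eq_convexHull hF.1 (hp.extremePoints_eq hi)

/-- The faces are the sets of points without a full block. -/
theorem HasPolygonDependences.mem_boundaryComplex_iff (hp : HasPolygonDependences p c)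
    (hi : 1 ≤ i) (S : Finset (EuclideanSpace ℝ (Fin d))) :
    S ∈ boundaryComplex (convexHull ℝ (Set.range p)) ↔
      ∃ T : Set (ZMod (2 * i + 1) × Bool), (S : Set _) = p '' T ∧ ∀ j, ¬ block i j ⊆ T := by
  have hext : ∀ F, IsProperFace (convexHull ℝ (Set.range p)) F →
      F.extremePoints ℝ = p '' {v | p v ∈ F} := by
    intro F hF
    rw [IsExposed.extremePoints_eq_inter hF.1, hp.extremePoints_eq hi]
    exact (Set.image_preimage_eq_inter_range).symm
  constructor
  · rintro ⟨F, hF, hS⟩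
    exact ⟨{v | p v ∈ F}, hS.trans (hext F hF), hp.not_block_subset_face hi hF⟩
  · rintro ⟨T, hS, hT⟩
    obtain ⟨F, hF, hFT⟩ := hp.exists_face hT
    refine ⟨F, hF, ?_⟩
    rw [hext F hF, hS, show {v | p v ∈ F} = T from Set.ext hFT]

theorem HasPolygonDependences.faceCount_eq (hp : HasPolygonDependences p c)
    {m : ℕ} (hm : m < 2 * i) :
    faceCount (boundaryComplex (convexHull ℝ (Set.range p))) m = (2 * (2 * i + 1)).choose m := by
  classical
  have hi : 1 ≤ i := by omega
  have hinj := hp.injective hi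
  have h : {S | S ∈ boundaryComplex (convexHull ℝ (Set.range p)) ∧ S.card = m} =
      (((Finset.univ : Finset (ZMod (2 * i + 1) × Bool)).powersetCard m).map
        (Finset.mapEmbedding ⟨p, hinj⟩).toEmbedding : Finset (Finset _)) := by
    ext S
    simp only [Set.mem_ofPred_eq, Finset.coe_map, Set.mem_image, Finset.mem_coe,
      Finset.mem_powersetCard, Finset.subset_univ, true_and]
    constructor
    · rintro ⟨hS, hcard⟩
      obtain ⟨T, hT, -⟩ := (hp.mem_boundaryComplex_iff hi S).1 hS
      have hST : T.toFinset.map ⟨p, hinj⟩ = S := by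
        apply Finset.coe_injective
        simp [hT]
      exact ⟨T.toFinset, by rw [← hcard, ← hST, Finset.card_map], hST⟩
    · rintro ⟨T, hT, rfl⟩
      refine ⟨(hp.mem_boundaryComplex_iff hi _).2 ⟨T, Finset.coe_map _ _,
        not_block_subset (by omega)⟩, ?_⟩
      rw [← hT]
      exact Finset.card_map _
  rw [faceCount, h, Set.ncard_coe_finset, Finset.card_map, Finset.card_powersetCard,
    Finset.card_univ, Fintype.card_prod, ZMod.card, Fintype.card_bool, mul_comm]

theorem HasPolygonDependences.isMissingFace_iff (hp : HasPolygonDependences p c) (hi : 1 ≤ i)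
    (S : Finset (EuclideanSpace ℝ (Fin d))) :
    IsMissingFace (boundaryComplex (convexHull ℝ (Set.range p))) S ↔
      ∃ j : ZMod (2 * i + 1), (S : Set _) = p '' block i j := by
  classical
  have hinj := hp.injective hi
  have hblock : ∀ S : Finset (EuclideanSpace ℝ (Fin d)), ∀ j, (S : Set _) = p '' block i j →
      S ∉ boundaryComplex (convexHull ℝ (Set.range p)) := by
    intro S j hS hmem
    obtain ⟨T, hT, hTb⟩ := (hp.mem_boundaryComplex_iff hi S).1 hmem
    exact hTb j (hinj.image_injective (hS.symm.trans hT)).subset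
  constructor
  · rintro ⟨h1, h2, h3⟩
    obtain ⟨T, hT⟩ : ∃ T, (S : Set _) = p '' T := by
      refine Set.subset_range_iff_exists_image_eq.1 (fun x hx => ?_) |>.imp fun _ => Eq.symm
      obtain ⟨T, hT, -⟩ := (hp.mem_boundaryComplex_iff hi _).1 (h1 x hx)
      obtain ⟨v, -, hv⟩ := hT.subset (Finset.mem_coe.2 (Finset.mem_singleton_self x))
      exact ⟨v, hv⟩
    have hb : ∃ j, block i j ⊆ T := by
      by_contra! hb
      exact h2 ((hp.mem_boundaryComplex_iff hi S).2 ⟨T, hT, hb⟩)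
    obtain ⟨j, hj⟩ := hb
    refine ⟨j, ?_⟩
    have hsub : p '' block i j ⊆ S := hT ▸ Set.image_mono hj
    have hfin : (p '' block i j).Finite := Set.toFinite _
    by_contra hne
    refine hblock hfin.toFinset j hfin.coe_toFinset (h3 _ ?_)
    rw [← Finset.coe_ssubset, hfin.coe_toFinset]
    exact hsub.ssubset_of_ne (Ne.symm hne)
  · rintro ⟨j, hS⟩
    refine ⟨fun x hx => ?_, hblock S j hS, fun T hT => ?_⟩
    · obtain ⟨v, -, rfl⟩ := hS.subset (Finset.mem_coe.2 hx)
      refine (hp.mem_boundaryComplex_iff hi _).2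
        ⟨(({v} : Finset (ZMod (2 * i + 1) × Bool)) : Set _), by simp,
          not_block_subset (by rw [Finset.card_singleton]; omega)⟩
    · rw [← Finset.coe_ssubset, hS] at hT
      obtain ⟨U, hU, hUT⟩ := Set.subset_image_iff.1 hT.subset
      refine (hp.mem_boundaryComplex_iff hi _).2 ⟨U, hUT.symm, fun j' hj' => hT.ne ?_⟩
      -- Blocks have equal size, so none contains another properly.
      have hjj : block i j' = block i j := Set.eq_of_subset_of_ncard_le (hj'.trans hU)
        (by rw [ncard_block, ncard_block]) (Set.toFinite _)
      rw [← hUT, hU.antisymm (hjj ▸ hj')]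

end

/-! ### Existence -/

/-- A subspace of `ℝ^ι` of vectors with zero sum is the space of affine dependences of a family
of points. -/
theorem exists_affineDependences_eq {ι : Type*} [Fintype ι] [Nonempty ι] {d : ℕ}
    (W : Submodule ℝ (ι → ℝ)) (hW : ∀ a ∈ W, ∑ j, a j = 0)
    (hd : Module.finrank ℝ W + (d + 1) = Fintype.card ι) :
    ∃ p : ι → EuclideanSpace ℝ (Fin d), affineDependences p = W := by
  classical
  set s : (ι → ℝ) →ₗ[ℝ] ℝ := Fintype.linearCombination ℝ fun _ => (1 : ℝ)
  have hs : ∀ a, s a = ∑ j, a j := fun a => by simp [s, Fintype.linearCombination_apply]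
  -- The coordinate sum descends to the quotient by `W`. The classes of the unit vectors lie on the
  -- hyperplane `σ = 1`; projected to `ker σ ≅ ℝ^d` they are the required points.
  set σ : (ι → ℝ) ⧸ W →ₗ[ℝ] ℝ := W.liftQ s fun a ha => by
    rw [LinearMap.mem_ker, hs, hW a ha]
  have hσ : ∀ a, σ (W.mkQ a) = ∑ j, a j := fun a => by
    rw [← hs]; exact W.liftQ_apply _ _
  have hσsurj : LinearMap.range σ = ⊤ := by
    rw [LinearMap.range_eq_top]
    obtain ⟨j⟩ := ‹Nonempty ι›
    intro r
    exact ⟨W.mkQ (Pi.single j r), by rw [hσ]; simp⟩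
  have hker : Module.finrank ℝ (LinearMap.ker σ) = d := by
    have h1 := σ.finrank_range_add_finrank_ker
    have h2 := W.finrank_quotient_add_finrank
    rw [hσsurj, finrank_top, Module.finrank_self] at h1
    rw [Module.finrank_fintype_fun_eq_card] at h2
    omega
  obtain ⟨π, hπ⟩ := (LinearMap.ker σ).subtype.exists_leftInverse_of_injective
    (Submodule.ker_subtype _)
  let e : LinearMap.ker σ ≃ₗ[ℝ] EuclideanSpace ℝ (Fin d) :=
    LinearEquiv.ofFinrankEq _ _ (by rw [hker, finrank_euclideanSpace_fin])
  refine ⟨fun j => e (π (W.mkQ (Pi.single j 1))), ?_⟩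
  have hp : ∀ a : ι → ℝ, ∑ j, a j • e (π (W.mkQ (Pi.single j 1))) = e (π (W.mkQ a)) := by
    intro a
    conv_rhs => rw [pi_eq_sum_univ' a]
    simp only [map_sum, map_smul]
  ext a
  rw [mem_affineDependences, hp]
  constructor
  · rintro ⟨h1, h2⟩
    have h3 : W.mkQ a ∈ LinearMap.ker σ := by rw [LinearMap.mem_ker, hσ, h2]
    have h4 : π (W.mkQ a) = ⟨W.mkQ a, h3⟩ := LinearMap.congr_fun hπ ⟨W.mkQ a, h3⟩
    rw [LinearEquiv.map_eq_zero_iff, h4, Submodule.mk_eq_zero] at h1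
    exact (Submodule.Quotient.mk_eq_zero W).1 h1
  · intro ha
    have h1 : W.mkQ a = 0 := (Submodule.Quotient.mk_eq_zero W).2 ha
    rw [h1, map_zero, map_zero]
    exact ⟨rfl, hW a ha⟩

theorem exists_isGaleDiagram_doublePolygon {i d : ℕ} (hi : 1 ≤ i) (hd : d + 1 = 4 * i) :
    ∃ p : ZMod (2 * i + 1) × Bool → EuclideanSpace ℝ (Fin d),
      IsGaleDiagram p (doublePolygon i) := by
  have hT : ∀ j, ¬ block i j ⊆ (∅ : Set (ZMod (2 * i + 1) × Bool)) := fun j h =>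
    h (show ((j, false) : ZMod (2 * i + 1) × Bool) ∈ block i j from ⟨0, by omega, by simp⟩)
  -- A positive relation on all vertices: its weights make the columns sum to zero and disappear
  -- again on normalization.
  obtain ⟨c, -, hc, hcos, hsin⟩ := exists_pos_relation hT
  have hc : ∀ v, 0 < c v := fun v => hc v (Set.notMem_empty v)
  set g : ZMod (2 * i + 1) × Bool → EuclideanSpace ℝ (Fin 2) :=
    fun v => c v • polygonVertex i v.1
  have hg0 : ∀ v, g v 0 = c v * Real.cos (polygonAngle i v.1) := fun _ => rfl
  have hg1 : ∀ v, g v 1 = c v * Real.sin (polygonAngle i v.1) := fun _ => rfl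
  set Λ : (Fin 2 → ℝ) →ₗ[ℝ] (ZMod (2 * i + 1) × Bool → ℝ) :=
    LinearMap.pi fun v => Fintype.linearCombination ℝ (fun l => g v l)
  have hΛ : ∀ u v, Λ u v = u 0 * g v 0 + u 1 * g v 1 := fun u v => by
    simp [Λ, Fintype.linearCombination_apply]
  have hinj : Function.Injective Λ := by
    rw [← LinearMap.ker_eq_bot, LinearMap.ker_eq_bot']
    intro u hu
    obtain ⟨h0, h1⟩ := eq_zero_of_forall_notMem hT (x := u 0) (y := u 1) fun v _ => by
      have h := congrFun hu v
      rw [hΛ, hg0, hg1, Pi.zero_apply] at h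
      refine (mul_eq_zero.1 ?_).resolve_left (hc v).ne'
      linear_combination h
    ext l
    fin_cases l
    · exact h0
    · exact h1
  obtain ⟨p, hp⟩ := exists_affineDependences_eq (d := d) (LinearMap.range Λ) (by
      rintro _ ⟨u, rfl⟩
      simp_rw [hΛ, Finset.sum_add_distrib, ← Finset.mul_sum, hg0, hg1, hcos, hsin]
      simp) (by
      rw [LinearMap.finrank_range_of_inj hinj, Module.finrank_fintype_fun_eq_card, Fintype.card_fin,
        Fintype.card_prod, ZMod.card, Fintype.card_bool]
      omega)
  refine ⟨p, g, ⟨((Pi.basisFun ℝ (Fin 2)).map (LinearEquiv.ofInjective Λ hinj)).map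
    (LinearEquiv.ofEq _ _ hp.symm), fun v l => ?_⟩, fun v => ?_⟩
  · simp only [Module.Basis.map_apply, LinearEquiv.coe_ofEq_apply, LinearEquiv.ofInjective_apply,
      Pi.basisFun_apply, hΛ]
    fin_cases l <;> simp
  · rw [norm_smul, norm_polygonVertex, mul_one, Real.norm_of_nonneg (hc v).le, smul_smul,
      inv_mul_cancel₀ (hc v).ne', one_smul, doublePolygon]

end GalePolytope

theorem mainTheorem8 (i k : ℕ) (hk : k + 1 = 2 * i) :
    (∃ p : ZMod (2 * i + 1) × Bool → EuclideanSpace ℝ (Fin (2 * k + 1)),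
      GalePolytope.IsGaleDiagram p (GalePolytope.doublePolygon i)) ∧
    ∀ p : ZMod (2 * i + 1) × Bool → EuclideanSpace ℝ (Fin (2 * k + 1)),
      GalePolytope.IsGaleDiagram p (GalePolytope.doublePolygon i) →
      -- the vertices of the polytope are exactly the pairwise distinct points `p v`
      Function.Injective p ∧
      (convexHull ℝ (Set.range p)).extremePoints ℝ = Set.range p ∧
      ((convexHull ℝ (Set.range p)).extremePoints ℝ).ncard = 2 * k + 4 ∧
      GalePolytope.polytopeDim (convexHull ℝ (Set.range p)) = 2 * k + 1 ∧
      GalePolytope.IsSimplicial (convexHull ℝ (Set.range p)) ∧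
      GalePolytope.IsNeighborly (convexHull ℝ (Set.range p)) ∧
      -- the missing faces are exactly the blocks of `i` consecutive double points
      (∀ S : Finset (EuclideanSpace ℝ (Fin (2 * k + 1))),
        GalePolytope.IsMissingFace
            (GalePolytope.boundaryComplex (convexHull ℝ (Set.range p))) S ↔
          ∃ j : ZMod (2 * i + 1), (S : Set _) = p '' GalePolytope.block i j) ∧
      -- every missing face has dimension `k`
      ∀ S : Finset (EuclideanSpace ℝ (Fin (2 * k + 1))),
        GalePolytope.IsMissingFace
            (GalePolytope.boundaryComplex (convexHull ℝ (Set.range p))) S →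
          S.card = k + 1 := by
  obtain ⟨i, rfl⟩ : ∃ i', i = i' + 1 := ⟨i - 1, by omega⟩
  have hi : 1 ≤ i + 1 := by omega
  refine ⟨GalePolytope.exists_isGaleDiagram_doublePolygon hi (by omega), fun p hp => ?_⟩
  obtain ⟨c, hc⟩ := GalePolytope.IsGaleDiagram.exists_hasPolygonDependences hp
  have hinj := hc.injective hi
  have hdim : GalePolytope.polytopeDim (convexHull ℝ (Set.range p)) = 2 * k + 1 := by
    apply GalePolytope.polytopeDim_convexHull_range
    rw [GalePolytope.IsGaleDiagram.finrank_affineDependences hp, Fintype.card_prod, ZMod.card,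
      Fintype.card_bool]
    omega
  refine ⟨hinj, hc.extremePoints_eq hi, ?_, hdim, hc.isSimplicial hi, ?_,
    hc.isMissingFace_iff hi, fun S hS => ?_⟩
  · rw [hc.extremePoints_eq hi, ← Set.image_univ, Set.ncard_image_of_injective _ hinj,
      Set.ncard_univ, Nat.card_eq_fintype_card, Fintype.card_prod, ZMod.card, Fintype.card_bool]
    omega
  -- Both `⌊(2k+1)/2⌋ = k` and `1` are less than the block size `2i`, so all sets of these sizes are
  -- faces.
  · rw [GalePolytope.IsNeighborly, GalePolytope.IsMNeighborly, hdim,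
      hc.faceCount_eq (by omega), hc.faceCount_eq (by omega), Nat.choose_one_right]
  · obtain ⟨j, hj⟩ := (hc.isMissingFace_iff hi S).1 hS
    rw [← Set.ncard_coe_finset, hj, Set.ncard_image_of_injective _ hinj,
      GalePolytope.ncard_block, hk]
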